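/- All graphs are finite and simple. For a connected graph $\Gamma$ with path distance $d$, a set $S$ of vertices is a resolving set if for every two distinct vertices $x,y$ there is $s\in S$ with $d(x,s)\ne d(y,s)$; the metric dimension $\dim(\Gamma)$ is the minimum cardinality of a resolving set. The corona product $G\odot H$ is obtained from one copy of $G$ and $|V(G)|$ disjoint copies of $H$, indexed by the vertices of $G$, by joining each vertex $v$ of $G$ to all vertices of the copy of $H$ with index $v$. Put $G\odot^1 H=G\odot H$ and $G\odot^k H=(G\odot^{k-1}H)\odot H$ for $k\ge 2$. Corollary. Let $G$ be a connected graph of order $n_1\ge 2$, let $n_2\ge 7$ and $k\ge 1$ be integers, and let $C_{n_2}$ and $P_{n_2}$ be the cycle and the path on $n_2$ vertices. Then (i) $\dim(G\odot^k C_{n_2})=n_1(n_2+1)^{k-1}\left\lfloor\frac{2n_2+2}{5}\right\rfloor$; (ii) $\dim(G\odot^k P_{n_2})=n_1(n_2+1)^{k-1}\left\lfloor\frac{2n_2+2}{5}\right\rfloor$. -/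

import Mathlib

universe u v

/-- `S` is a resolving set of `G`: distinct vertices have distinct vectors of distances to the
members of `S`. (Used for connected graphs.) -/
def IsResolvingSet {V : Type u} (G : SimpleGraph V) (S : Set V) : Prop :=
  ∀ x y : V, x ≠ y → ∃ s ∈ S, G.dist x s ≠ G.dist y s

/-- The metric dimension of `G`: the minimum cardinality of a resolving set. -/
noncomputable def metricDim {V : Type u} (G : SimpleGraph V) : ℕ∞ :=
  ⨅ S : {S : Set V // IsResolvingSet G S}, (S : Set V).encard

/-- The corona product `G ⊙ H`: one copy of `G` (the vertices `inl x`), and for each vertex `x` of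
`G` a copy of `H` (the vertices `inr (x, a)`), all of whose vertices are joined to `x`. -/
def corona {V : Type u} {W : Type v} (G : SimpleGraph V) (H : SimpleGraph W) :
    SimpleGraph (V ⊕ V × W) where
  Adj
    | .inl x, .inl y => G.Adj x y
    | .inl x, .inr (y, _) => x = y
    | .inr (x, _), .inl y => x = y
    | .inr (x, a), .inr (y, b) => x = y ∧ H.Adj a b
  symm := ⟨by
    rintro (x | ⟨x, a⟩) (y | ⟨y, b⟩) h
    · exact SimpleGraph.Adj.symm h
    · exact Eq.symm h
    · exact Eq.symm h
    · exact ⟨h.1.symm, SimpleGraph.Adj.symm h.2⟩⟩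
  loopless := ⟨by
    rintro (x | ⟨x, a⟩) h
    · exact G.irrefl h
    · exact H.irrefl h.2⟩

/-- The vertex type of the `k`-fold corona product. -/
def IterCoronaVertex (V : Type u) (W : Type) : ℕ → Type u
  | 0 => V
  | k + 1 => IterCoronaVertex V W k ⊕ IterCoronaVertex V W k × W

/-- The `k`-fold corona product `G ⊙ᵏ H`: it is `G` for `k = 0`, `G ⊙ H` for `k = 1`, and
`(G ⊙ᵏ⁻¹ H) ⊙ H` in general. -/
def iterCorona {V : Type u} {W : Type} (G : SimpleGraph V) (H : SimpleGraph W) :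
    (k : ℕ) → SimpleGraph (IterCoronaVertex V W k)
  | 0 => G
  | k + 1 => corona (iterCorona G H k) H

/-!
The distance from a vertex of a copy of `H` in `G ⊙ H` to anything outside that copy is the same
for all vertices of the copy, and inside the copy distances are truncated at `2` by the apex. Hence
a resolving set of `G ⊙ H` must contain, in each copy of `H`, a set `T` that tells the vertices
outside `T` apart by their neighbours in `T` (`IsResolvingSet.isAdjResolvingSet_copy`). Conversely,
once `G` has two vertices, such a nonempty set in every copy is enough
(`IsAdjResolvingSet.isResolvingSet_corona`). So the metric dimension of `G ⊙ H` is `|V(G)|` times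
the least size of such a `T` (`metricDim_corona`). As `G ⊙ᵏ H` is the corona of the connected graph
`G ⊙ᵏ⁻¹ H`, which has `|V(G)| (|V(H)| + 1) ^ (k - 1)` vertices, only this least size for paths and
cycles remains to be found.

If all degrees of `H` are at most `2`, double counting the edges between `T` and its complement
gives `2|V(H)| ≤ 5|T| + 2` (`IsAdjResolvingSet.two_mul_card_le`), that is,
`|T| ≥ ⌊(2|V(H)| + 2) / 5⌋`. For a path or a cycle on `{0, …, n - 1}` with `n ≥ 5`, the numbers
congruent to `1` or `3` modulo `5`, with one of them moved when `n` is `3` modulo `5`, attain this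
bound (`landmarks`).
-/

/-! ### Distances in a corona product -/

namespace SimpleGraph

theorem Connected.dist_le_dist_add_one_of_adj {V : Type*} {G : SimpleGraph V} (hG : G.Connected)
    (v : V) {x y : V} (h : G.Adj x y) : G.dist v y ≤ G.dist v x + 1 := by
  have := hG.dist_triangle (u := v) (v := x) (w := y)
  rwa [dist_eq_one_iff_adj.2 h] at this

/-- Distances are bounded below by the increments of functions that grow by at most `1` along each
edge. The lower bounds on distances in a corona product come from explicit such functions. -/
theorem Connected.le_add_dist_of_adj {V : Type*} {G : SimpleGraph V} (hG : G.Connected)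
    (f : V → ℕ) (hf : ∀ x y, G.Adj x y → f y ≤ f x + 1) (x y : V) :
    f y ≤ f x + G.dist x y := by
  obtain ⟨p, hp⟩ := hG.exists_walk_length_eq_dist x y
  rw [← hp]
  clear hp
  induction p with
  | nil => simp
  | cons h p ih =>
    have := hf _ _ h
    rw [Walk.length_cons]
    omega

end SimpleGraph

section Corona

variable {V W : Type*} {G : SimpleGraph V} {H : SimpleGraph W}

theorem corona_adj_inl_inr (v : V) (a : W) : (corona G H).Adj (.inl v) (.inr (v, a)) :=
  (rfl : v = v)

/-- The inclusion of the central copy of `G` in `G ⊙ H`. -/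
def coronaInl (G : SimpleGraph V) (H : SimpleGraph W) : G →g corona G H where
  toFun := .inl
  map_rel' h := h

theorem corona_connected (hG : G.Connected) : (corona G H).Connected := by
  have hl : ∀ v w : V, (corona G H).Reachable (.inl v) (.inl w) := fun v w =>
    (hG.preconnected v w).map (coronaInl G H)
  have hr : ∀ (v : V) (a : W), (corona G H).Reachable (.inl v) (.inr (v, a)) := fun v a =>
    (corona_adj_inl_inr v a).reachable
  have : Nonempty (V ⊕ V × W) := hG.nonempty.map .inl
  refine ⟨?_⟩
  rintro (v | ⟨v, a⟩) (w | ⟨w, b⟩)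
  · exact hl v w
  · exact (hl v w).trans (hr w b)
  · exact (hr v a).symm.trans (hl v w)
  · exact (hr v a).symm.trans ((hl v w).trans (hr w b))

theorem corona_dist_inl_inl_le (hG : G.Connected) (v w : V) :
    (corona G H).dist (.inl v) (.inl w) ≤ G.dist v w := by
  obtain ⟨p, hp⟩ := hG.exists_walk_length_eq_dist v w
  rw [← hp, ← p.length_map (coronaInl G H)]
  exact SimpleGraph.dist_le _

/-- The distance of a corona product from a vertex of the central copy. -/
theorem corona_dist_inl (hG : G.Connected) (v : V) (x : V ⊕ V × W) :
    (corona G H).dist (.inl v) x = x.elim (G.dist v) (fun q => G.dist v q.1 + 1) := by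
  apply le_antisymm
  · rcases x with w | ⟨w, b⟩
    · exact corona_dist_inl_inl_le hG v w
    · have h1 := (corona_connected (H := H) hG).dist_triangle (u := .inl v) (v := .inl w)
        (w := .inr (w, b))
      rw [SimpleGraph.dist_eq_one_iff_adj.2 (corona_adj_inl_inr w b)] at h1
      exact h1.trans (Nat.add_le_add_right (corona_dist_inl_inl_le hG v w) 1)
  · have := (corona_connected (H := H) hG).le_add_dist_of_adj
      (fun x => x.elim (G.dist v) (fun q => G.dist v q.1 + 1)) ?_ (.inl v) x
    · simpa using this
    · rintro (x | ⟨x, a⟩) (y | ⟨y, b⟩) h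
      · exact hG.dist_le_dist_add_one_of_adj v h
      · obtain rfl : x = y := h
        simp
      · obtain rfl : x = y := h
        simp only [Sum.elim_inl, Sum.elim_inr]
        omega
      · obtain ⟨rfl, -⟩ : x = y ∧ H.Adj a b := h
        simp

/-- Every path leaving a copy of `H` passes through its apex, so the distance to a vertex outside
that copy does not depend on the starting point in it. -/
theorem corona_dist_inr_inr_of_ne (hG : G.Connected) {v w : V} (hvw : v ≠ w) (a b : W) :
    (corona G H).dist (.inr (v, a)) (.inr (w, b)) = G.dist v w + 2 := by
  classical
  apply le_antisymm
  · have h1 := (corona_connected (H := H) hG).dist_triangle (u := .inr (v, a)) (v := .inl v)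
      (w := .inr (w, b))
    rw [SimpleGraph.dist_eq_one_iff_adj.2 (corona_adj_inl_inr v a).symm,
      corona_dist_inl hG] at h1
    simp only [Sum.elim_inr] at h1
    omega
  · have := (corona_connected (H := H) hG).le_add_dist_of_adj
      (fun x => x.elim (fun y => G.dist v y + 1)
        (fun q => if q.1 = v then 0 else G.dist v q.1 + 2)) ?_ (.inr (v, a)) (.inr (w, b))
    · simpa [hvw.symm] using this
    · rintro (x | ⟨x, a⟩) (y | ⟨y, b⟩) h
      · have := hG.dist_le_dist_add_one_of_adj v h
        simp only [Sum.elim_inl]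
        omega
      · obtain rfl : x = y := h
        simp only [Sum.elim_inl, Sum.elim_inr]
        split_ifs <;> omega
      · obtain rfl : x = y := h
        by_cases hx : x = v <;> simp [hx]
      · obtain ⟨rfl, -⟩ : x = y ∧ H.Adj a b := h
        simp

open Classical in
theorem corona_dist_inr_inr_same (hG : G.Connected) (v : V) (a b : W) :
    (corona G H).dist (.inr (v, a)) (.inr (v, b)) =
      if a = b then 0 else if H.Adj a b then 1 else 2 := by
  have hc := corona_connected (H := H) hG
  split_ifs with hab h
  · rw [hab, SimpleGraph.dist_self]
  · exact SimpleGraph.dist_eq_one_iff_adj.2 ⟨rfl, h⟩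
  · have h0 : (corona G H).dist (.inr (v, a)) (.inr (v, b)) ≠ 0 := fun h0 => hab <| by
      simpa using hc.dist_eq_zero_iff.1 h0
    have h1 : (corona G H).dist (.inr (v, a)) (.inr (v, b)) ≠ 1 := fun h1 =>
      h (SimpleGraph.dist_eq_one_iff_adj.1 h1).2
    have h2 := hc.dist_triangle (u := .inr (v, a)) (v := .inl v) (w := .inr (v, b))
    rw [SimpleGraph.dist_eq_one_iff_adj.2 (corona_adj_inl_inr v a).symm,
      SimpleGraph.dist_eq_one_iff_adj.2 (corona_adj_inl_inr v b)] at h2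
    omega

end Corona

/-! ### Adjacency resolving sets and the metric dimension of a corona product -/

/-- `S` is an adjacency resolving set of `H`: distinct vertices outside `S` have distinct sets of
neighbours in `S`. Vertices of `S` need no condition, being at distance `0` from themselves only.
One vertex outside `S` may have no neighbour in `S` at all. -/
def IsAdjResolvingSet {W : Type*} (H : SimpleGraph W) (S : Set W) : Prop :=
  ∀ a ∉ S, ∀ b ∉ S, (∀ s ∈ S, H.Adj a s ↔ H.Adj b s) → a = b

section Corona

variable {V W : Type*} {G : SimpleGraph V} {H : SimpleGraph W}

/-- Only the landmarks inside a copy of `H` separate the vertices of that copy. -/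
theorem IsResolvingSet.isAdjResolvingSet_copy (hG : G.Connected) {S : Set (V ⊕ V × W)}
    (hS : IsResolvingSet (corona G H) S) (v : V) :
    IsAdjResolvingSet H {a | Sum.inr (v, a) ∈ S} := by
  classical
  intro a ha b hb hab
  by_contra hne
  obtain ⟨s, hs, hd⟩ := hS (.inr (v, a)) (.inr (v, b)) (by simpa using hne)
  apply hd
  rcases s with w | ⟨w, c⟩
  · rw [SimpleGraph.dist_comm, SimpleGraph.dist_comm (u := Sum.inr (v, b)), corona_dist_inl hG,
      corona_dist_inl hG]
    rfl
  · by_cases hvw : v = w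
    · subst hvw
      have hac : a ≠ c := fun h => ha (h ▸ hs)
      have hbc : b ≠ c := fun h => hb (h ▸ hs)
      rw [corona_dist_inr_inr_same hG, corona_dist_inr_inr_same hG, if_neg hac, if_neg hbc]
      exact if_congr (hab c hs) rfl rfl
    · rw [corona_dist_inr_inr_of_ne hG hvw, corona_dist_inr_inr_of_ne hG hvw]

/-- The union of copies of a nonempty adjacency resolving set resolves the corona product. Two
vertices in different blocks `{v} ∪ H_v` are separated by the landmarks of one of these blocks, and
an apex is separated from its own copy of `H` by the landmarks of another block. -/
theorem IsAdjResolvingSet.isResolvingSet_corona [Nontrivial V] (hG : G.Connected) {T : Set W}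
    (hT : IsAdjResolvingSet H T) (hne : T.Nonempty) :
    IsResolvingSet (corona G H) (Sum.inr '' (Set.univ ×ˢ T)) := by
  classical
  obtain ⟨t, ht⟩ := hne
  have hmem : ∀ v : V, ∀ c ∈ T, (Sum.inr (v, c) : V ⊕ V × W) ∈ Sum.inr '' (Set.univ ×ˢ T) :=
    fun v c hc => ⟨(v, c), ⟨trivial, hc⟩, rfl⟩
  have hpos : ∀ {v w : V}, v ≠ w → 0 < G.dist v w := fun h => hG.pos_dist_of_ne h
  have hlr : ∀ (v w : V) (a : W), ∃ s ∈ (Sum.inr '' (Set.univ ×ˢ T) : Set (V ⊕ V × W)),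
      (corona G H).dist (.inl v) s ≠ (corona G H).dist (.inr (w, a)) s := by
    intro v w a
    by_cases hvw : v = w
    · subst hvw
      obtain ⟨u, hu⟩ := exists_ne v
      refine ⟨_, hmem u t ht, ?_⟩
      rw [corona_dist_inl hG, corona_dist_inr_inr_of_ne hG hu.symm]
      simp
    · refine ⟨_, hmem v t ht, ?_⟩
      rw [corona_dist_inl hG, corona_dist_inr_inr_of_ne hG (Ne.symm hvw)]
      simp
  rintro (v | ⟨v, a⟩) (w | ⟨w, b⟩) hxy
  · have hvw : v ≠ w := fun h => hxy (h ▸ rfl)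
    refine ⟨_, hmem v t ht, ?_⟩
    have := hpos hvw.symm
    rw [corona_dist_inl hG, corona_dist_inl hG]
    simp only [Sum.elim_inr, SimpleGraph.dist_self]
    omega
  · exact hlr v w b
  · obtain ⟨s, hs, h⟩ := hlr w v a
    exact ⟨s, hs, h.symm⟩
  · by_cases hvw : v = w
    · subst hvw
      have hab : a ≠ b := fun h => hxy (h ▸ rfl)
      by_cases ha : a ∈ T
      · refine ⟨_, hmem v a ha, ?_⟩
        rw [corona_dist_inr_inr_same hG, corona_dist_inr_inr_same hG, if_pos rfl, if_neg hab.symm]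
        split_ifs <;> simp
      by_cases hb : b ∈ T
      · refine ⟨_, hmem v b hb, ?_⟩
        rw [corona_dist_inr_inr_same hG, corona_dist_inr_inr_same hG, if_pos rfl, if_neg hab]
        split_ifs <;> simp
      have := mt (hT a ha b hb) hab
      push Not at this
      obtain ⟨c, hc, h⟩ := this
      refine ⟨_, hmem v c hc, ?_⟩
      have hac : a ≠ c := fun h => ha (h ▸ hc)
      have hbc : b ≠ c := fun h => hb (h ▸ hc)
      rw [corona_dist_inr_inr_same hG, corona_dist_inr_inr_same hG, if_neg hac, if_neg hbc]
      rcases h with ⟨h1, h2⟩ | ⟨h1, h2⟩ <;> simp [h1, h2]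
    · refine ⟨_, hmem v t ht, ?_⟩
      have := hpos (Ne.symm hvw)
      rw [corona_dist_inr_inr_same hG, corona_dist_inr_inr_of_ne hG (Ne.symm hvw)]
      split_ifs <;> omega

/-- The metric dimension of `G ⊙ H` is `|V(G)|` times the minimum size `m` of an adjacency
resolving set of `H`. -/
theorem metricDim_corona [Finite V] [Nontrivial V] [Finite W] (hG : G.Connected) {m : ℕ}
    (hm : 0 < m) (hex : ∃ T : Finset W, IsAdjResolvingSet H T ∧ T.card ≤ m)
    (hmin : ∀ T : Finset W, IsAdjResolvingSet H T → m ≤ T.card) :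
    metricDim (corona G H) = ((Nat.card V * m : ℕ) : ℕ∞) := by
  classical
  have := Fintype.ofFinite V
  have := Fintype.ofFinite W
  rw [Nat.card_eq_fintype_card]
  apply le_antisymm
  · obtain ⟨T, hT, hTm⟩ := hex
    have hne : (T : Set W).Nonempty :=
      Finset.coe_nonempty.2 (Finset.card_pos.1 (hm.trans_le (hmin T hT)))
    refine (iInf_le _ ⟨_, hT.isResolvingSet_corona hG hne⟩).trans ?_
    rw [Sum.inr_injective.encard_image, ← Finset.coe_univ, ← Finset.coe_product,
      Set.encard_coe_eq_coe_finsetCard, Finset.card_product, Finset.card_univ]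
    exact_mod_cast Nat.mul_le_mul_left _ hTm
  · refine le_iInf fun ⟨S, hS⟩ => ?_
    have hcopy : ∀ v : V, m ≤ (Finset.univ.filter fun a : W => Sum.inr (v, a) ∈ S).card :=
      fun v => hmin _ (by simpa using hS.isAdjResolvingSet_copy hG v)
    let P : Finset (V × W) := Finset.univ.filter fun q => Sum.inr q ∈ S
    have hP : P.card = ∑ v : V, (Finset.univ.filter fun a : W => Sum.inr (v, a) ∈ S).card := by
      simp only [P, Finset.card_filter, Fintype.sum_prod_type]
    have hle : Fintype.card V * m ≤ P.card := by
      rw [hP, ← Finset.card_univ, ← smul_eq_mul]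
      exact Finset.card_nsmul_le_sum _ _ _ fun v _ => hcopy v
    calc ((Fintype.card V * m : ℕ) : ℕ∞) ≤ P.card := by exact_mod_cast hle
      _ = (Sum.inr '' (P : Set (V × W)) : Set (V ⊕ V × W)).encard := by
        rw [Sum.inr_injective.encard_image, Set.encard_coe_eq_coe_finsetCard]
      _ ≤ S.encard := Set.encard_le_encard (by rintro _ ⟨q, hq, rfl⟩; simpa [P] using hq)

end Corona

/-! ### Adjacency resolving sets of paths and cycles -/

/-- The double counting bound. Among the vertices outside `T`, at most one has no neighbour in `T`
and at most `|T|` have exactly one; each of the others takes two or more of the at most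
`2|T|` edges leaving `T`. -/
theorem IsAdjResolvingSet.two_mul_card_le {W : Type*} [Fintype W] {H : SimpleGraph W}
    [DecidableRel H.Adj] (hdeg : ∀ a, H.degree a ≤ 2) {T : Finset W}
    (hT : IsAdjResolvingSet H T) : 2 * Fintype.card W ≤ 5 * T.card + 2 := by
  classical
  let N : W → Finset W := fun a => T.filter (H.Adj a)
  have hinj : Set.InjOn N (Tᶜ : Finset W) := by
    intro a ha b hb hab
    refine hT a (by simpa using ha) b (by simpa using hb) fun s hs => ?_
    have := Finset.ext_iff.1 hab s
    simpa [N, Finset.mem_coe.1 hs] using this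
  have hedges : ∑ a ∈ Tᶜ, (N a).card ≤ T.card * 2 := by
    calc ∑ a ∈ Tᶜ, (N a).card = ∑ s ∈ T, (Finset.bipartiteBelow H.Adj Tᶜ s).card :=
          Finset.sum_card_bipartiteAbove_eq_sum_card_bipartiteBelow H.Adj
      _ ≤ T.card * 2 := by
          refine Finset.sum_le_card_nsmul _ _ _ fun s _ => (Finset.card_le_card ?_).trans (hdeg s)
          intro a ha
          simpa [Finset.bipartiteBelow, SimpleGraph.adj_comm] using (Finset.mem_filter.1 ha).2
  have hzero : (Tᶜ.filter fun a => (N a).card = 0).card ≤ 1 := by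
    refine Finset.card_le_one.2 fun a ha b hb => ?_
    rw [Finset.mem_filter, Finset.card_eq_zero] at ha hb
    exact hinj ha.1 hb.1 (ha.2.trans hb.2.symm)
  have hone : (Tᶜ.filter fun a => (N a).card = 1).card ≤ T.card := by
    rw [← Nat.choose_one_right T.card, ← Finset.card_powersetCard]
    refine Finset.card_le_card_of_injOn N (fun a ha => ?_) fun a ha b hb hab =>
      hinj (Finset.mem_filter.1 ha).1 (Finset.mem_filter.1 hb).1 hab
    exact Finset.mem_powersetCard.2 ⟨Finset.filter_subset _ _, (Finset.mem_filter.1 ha).2⟩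
  have hsum : ∑ _a ∈ Tᶜ, 2 ≤ ∑ a ∈ Tᶜ,
      ((N a).card + ((if (N a).card = 1 then 1 else 0) + 2 * if (N a).card = 0 then 1 else 0)) :=
    Finset.sum_le_sum fun a _ => by split_ifs <;> omega
  rw [Finset.sum_add_distrib, Finset.sum_add_distrib, ← Finset.mul_sum, ← Finset.card_filter,
    ← Finset.card_filter, Finset.sum_const, smul_eq_mul] at hsum
  have := T.card_add_card_compl
  omega

/-- The numbers below `n` congruent to `1` or `3` modulo `5`. Consecutive numbers outside this set
have the neighbourhoods `{5j + 1}`, `{5j + 1, 5j + 3}`, `{5j + 3}` in it. -/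
def oneThreeModFive (n : ℕ) : Finset ℕ :=
  (Finset.range n).filter fun i => i % 5 = 1 ∨ i % 5 = 3

theorem card_oneThreeModFive (n : ℕ) : (oneThreeModFive n).card = (2 * n + 2) / 5 := by
  induction n with
  | zero => rfl
  | succ n ih =>
    rw [oneThreeModFive, Finset.range_add_one, Finset.filter_insert]
    split_ifs with h
    · rw [Finset.card_insert_of_notMem (by simp), ← oneThreeModFive, ih]
      omega
    · rw [← oneThreeModFive, ih]
      omega

/-- Landmarks for the path and the cycle on `{0, …, n - 1}`. When `n = 5q + 3`, the numbers `5q`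
and `5q + 2` would both have the single landmark `5q + 1` as neighbour; taking `5q` in its place
avoids this. -/
def landmarks (n : ℕ) : Finset ℕ :=
  if n % 5 = 3 then insert (n - 3) (oneThreeModFive (n - 3)) else oneThreeModFive n

theorem card_landmarks_le (n : ℕ) : (landmarks n).card ≤ (2 * n + 2) / 5 := by
  rw [landmarks]
  split_ifs with h
  · refine (Finset.card_insert_le _ _).trans ?_
    rw [card_oneThreeModFive]
    omega
  · exact (card_oneThreeModFive n).le

theorem mem_landmarks {n i : ℕ} : i ∈ landmarks n ↔
    (n % 5 = 3 ∧ (i + 3 = n ∨ i + 3 < n ∧ (i % 5 = 1 ∨ i % 5 = 3))) ∨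
      (n % 5 ≠ 3 ∧ i < n ∧ (i % 5 = 1 ∨ i % 5 = 3)) := by
  rw [landmarks]
  split_ifs with h <;> simp [oneThreeModFive, h]
  omega

/-- Numbers outside `landmarks n` are determined by their neighbours in it. The proposition `c` says
whether the ends `0` and `n - 1` are joined, so that both the path and the cycle are
covered. -/
theorem eq_of_landmarks {n : ℕ} (hn : 5 ≤ n) {c : Prop} {r : ℕ → ℕ → Prop}
    (hr : ∀ a b, r a b ↔ a + 1 = b ∨ b + 1 = a ∨ c ∧ (a = 0 ∧ b + 1 = n ∨ b = 0 ∧ a + 1 = n))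
    {a b : ℕ} (ha : a < n) (hb : b < n) (haT : a ∉ landmarks n) (hbT : b ∉ landmarks n)
    (h : ∀ s ∈ landmarks n, r a s ↔ r b s) : a = b := by
  wlog hab : a < b generalizing a b
  · by_contra hne
    exact hne (this hb ha hbT haT (fun s hs => (h s hs).symm) (by omega)).symm
  -- A landmark next to one of `a`, `b` is next to the other. As `a < b`, it then lies between them,
  -- unless it is reached around the end of the cycle.
  have h1 : a + 1 ∈ landmarks n → b = a + 2 := fun hs => by
    have := (hr b (a + 1)).1 ((h _ hs).1 ((hr _ _).2 (.inl rfl)))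
    omega
  have h2 : 0 < a → a - 1 ∈ landmarks n → a = 1 := fun h0 hs => by
    have := (hr b (a - 1)).1 ((h _ hs).1 ((hr _ _).2 (.inr (.inl (by omega)))))
    omega
  have h3 : b + 1 ∈ landmarks n → a = 0 ∧ b + 2 = n := fun hs => by
    have := (hr a (b + 1)).1 ((h _ hs).2 ((hr _ _).2 (.inl rfl)))
    omega
  have h4 : b - 1 ∈ landmarks n → b = a + 2 := fun hs => by
    have := (hr a (b - 1)).1 ((h _ hs).2 ((hr _ _).2 (.inr (.inl (by omega)))))
    omega
  rw [mem_landmarks] at haT hbT h1 h2 h3 h4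
  by_cases h5 : n % 5 = 3
  · simp only [h5, true_and, ne_eq, not_true_eq_false, false_and, or_false] at haT hbT h1 h2 h3 h4
    rcases eq_or_ne b (a + 2) with rfl | hne <;> omega
  · simp only [h5, false_and, ne_eq, not_false_eq_true, true_and, false_or] at haT hbT h1 h2 h3 h4
    rcases eq_or_ne b (a + 2) with rfl | hne <;> omega

theorem exists_isAdjResolvingSet_fin {n : ℕ} (hn : 5 ≤ n) {H : SimpleGraph (Fin n)} (c : Prop)
    (hH : ∀ a b : Fin n, H.Adj a b ↔ a.val + 1 = b ∨ b.val + 1 = a ∨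
      c ∧ (a.val = 0 ∧ b.val + 1 = n ∨ b.val = 0 ∧ a.val + 1 = n)) :
    ∃ T : Finset (Fin n), IsAdjResolvingSet H T ∧ T.card ≤ (2 * n + 2) / 5 := by
  have hlt : ∀ i ∈ landmarks n, i < n := fun i hi => by
    rw [mem_landmarks] at hi
    omega
  refine ⟨(landmarks n).attachFin hlt, fun a ha b hb h => Fin.ext ?_, ?_⟩
  · refine eq_of_landmarks hn (c := c) (fun _ _ => Iff.rfl) a.2 b.2 (by simpa using ha)
      (by simpa using hb) fun s hs => ?_
    rw [← hH a ⟨s, hlt s hs⟩, ← hH b ⟨s, hlt s hs⟩]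
    exact h _ (by simpa using hs)
  · rw [Finset.card_attachFin]
    exact card_landmarks_le n

theorem SimpleGraph.cycleGraph_adj_iff_val {n : ℕ} (hn : 2 ≤ n) (a b : Fin n) :
    (SimpleGraph.cycleGraph n).Adj a b ↔ a.val + 1 = b ∨ b.val + 1 = a ∨
      (a.val = 0 ∧ b.val + 1 = n ∨ b.val = 0 ∧ a.val + 1 = n) := by
  have ha := a.2
  have hb := b.2
  rw [SimpleGraph.cycleGraph_adj']
  rcases le_or_gt a b with h | h
  · rcases h.eq_or_lt with rfl | h
    · have : (a - a).val = 0 := by simp [Fin.sub_def]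
      omega
    · rw [Fin.sub_val_of_le h.le, Fin.coe_sub_iff_lt.2 h]
      omega
  · rw [Fin.sub_val_of_le h.le, Fin.coe_sub_iff_lt.2 h]
    omega

/-! ### Iterated corona products -/

section IterCorona

variable {V : Type*} {W : Type} {G : SimpleGraph V} {H : SimpleGraph W}

theorem iterCorona_connected (hG : G.Connected) (k : ℕ) : (iterCorona G H k).Connected := by
  induction k with
  | zero => exact hG
  | succ k ih => exact corona_connected ih

theorem finite_iterCoronaVertex [Finite V] [Finite W] (k : ℕ) :
    Finite (IterCoronaVertex V W k) := by
  induction k with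
  | zero => assumption
  | succ k ih => exact inferInstanceAs (Finite (_ ⊕ _ × W))

theorem card_iterCoronaVertex [Finite V] [Finite W] (k : ℕ) :
    Nat.card (IterCoronaVertex V W k) = Nat.card V * (Nat.card W + 1) ^ k := by
  induction k with
  | zero => simp [IterCoronaVertex]
  | succ k ih =>
    have := finite_iterCoronaVertex (V := V) (W := W) k
    change Nat.card (IterCoronaVertex V W k ⊕ IterCoronaVertex V W k × W) = _
    rw [Nat.card_sum, Nat.card_prod, ih]
    ring

/-- For maximum degree at most `2` the double counting bound is `⌈(2|W| - 2) / 5⌉`, which equals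
`⌊(2|W| + 2) / 5⌋`; a single set `T` of that size therefore settles every iterate. -/
theorem metricDim_iterCorona [Finite V] [Nontrivial V] [Fintype W] [DecidableRel H.Adj]
    (hG : G.Connected) (hdeg : ∀ a, H.degree a ≤ 2) (hW : 2 ≤ Fintype.card W)
    (hex : ∃ T : Finset W, IsAdjResolvingSet H T ∧ T.card ≤ (2 * Fintype.card W + 2) / 5)
    (k : ℕ) : metricDim (iterCorona G H (k + 1)) =
      ((Nat.card V * (Fintype.card W + 1) ^ k * ((2 * Fintype.card W + 2) / 5) : ℕ) : ℕ∞) := by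
  have hfin := finite_iterCoronaVertex (V := V) (W := W) k
  have hcard := card_iterCoronaVertex (V := V) (W := W) k
  have : Nontrivial (IterCoronaVertex V W k) := by
    rw [← Finite.one_lt_card_iff_nontrivial, hcard]
    exact (Finite.one_lt_card (α := V)).trans_le
      (Nat.le_mul_of_pos_right _ (pow_pos (Nat.succ_pos _) _))
  rw [Nat.card_eq_fintype_card (α := W)] at hcard
  rw [← hcard]
  refine metricDim_corona (iterCorona_connected hG k) (by omega) hex fun T hT => ?_
  have := hT.two_mul_card_le hdeg
  omega

end IterCorona

theorem mainTheorem10 {V : Type*} [Fintype V] (G : SimpleGraph V) (hG : G.Connected)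
    (hV : 2 ≤ Fintype.card V) (n : ℕ) (hn : 7 ≤ n) (k : ℕ) (hk : 1 ≤ k) :
    metricDim (iterCorona G (SimpleGraph.cycleGraph n) k) =
        ((Fintype.card V * (n + 1) ^ (k - 1) * ((2 * n + 2) / 5) : ℕ) : ℕ∞) ∧
      metricDim (iterCorona G (SimpleGraph.pathGraph n) k) =
        ((Fintype.card V * (n + 1) ^ (k - 1) * ((2 * n + 2) / 5) : ℕ) : ℕ∞) := by
  classical
  have : Nontrivial V := Fintype.one_lt_card_iff_nontrivial.1 hV
  obtain ⟨k, rfl⟩ := Nat.exists_eq_add_of_le' hk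
  have hcycle : ∀ a, (SimpleGraph.cycleGraph n).degree a ≤ 2 := by
    obtain ⟨m, rfl⟩ := Nat.exists_eq_add_of_le' (show 2 ≤ n by omega)
    intro a
    rw [SimpleGraph.cycleGraph_degree_two_le]
    exact Finset.card_le_two
  have hpath : ∀ a, (SimpleGraph.pathGraph n).degree a ≤ 2 := fun a =>
    (SimpleGraph.degree_le_of_le SimpleGraph.pathGraph_le_cycleGraph).trans (hcycle a)
  have h1 := metricDim_iterCorona hG hcycle (by simp; omega) (by
    simpa using exists_isAdjResolvingSet_fin (by omega) True fun a b => by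
      simpa using SimpleGraph.cycleGraph_adj_iff_val (by omega) a b) k
  have h2 := metricDim_iterCorona hG hpath (by simp; omega) (by
    simpa using exists_isAdjResolvingSet_fin (by omega) False fun a b => by
      simpa using SimpleGraph.pathGraph_adj) k
  simp only [Nat.card_eq_fintype_card, Fintype.card_fin] at h1 h2
  exact ⟨h1, h2⟩
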